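/- Let $X=\prod_{h\in H}X_h$ be a product (with the Tychonoff product topology) of any family of Tychonoff pseudocompact topological spaces, and suppose that, for each $h\in H$, at least one of the following holds: $X_h$ is scattered; $X_h$ is first countable; $X_h$ is $\psi$-$\omega$-scattered; $X_h$ admits a group structure making it a topological group. Then $X$ is pseudocompact and, in fact, sequentially pseudocompact. In particular (Comfort--Ross), every product of pseudocompact Hausdorff topological groups is pseudocompact. Here a space is \emph{pseudocompact} if every continuous real-valued function on it is bounded; it is \emph{sequentially pseudocompact} if for every sequence $(O_n)_{n\in\omega}$ of pairwise disjoint nonempty open sets there are an infinite set $J\subseteq\omega$ and a point $x$ such that every neighborhood of $x$ intersects $O_n$ for all but finitely many $n\in J$; it is \emph{scattered} if every nonempty subset $S$ contains a point isolated in the subspace $S$; and it is \emph{$\psi$-$\omega$-scattered} if every nonempty closed subspace $F$ contains a point $x$ of countable pseudocharacter in $F$, that is, such that $\{x\}$ is the intersection of countably many relatively open subsets of $F$. -/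

import Mathlib

universe u v

/-- A topological space is pseudocompact if every continuous real-valued function on it is
bounded. -/
def IsPseudocompact (X : Type*) [TopologicalSpace X] : Prop :=
  ∀ f : X → ℝ, Continuous f → ∃ C : ℝ, ∀ x, |f x| ≤ C

/-- A topological space is sequentially pseudocompact if for every sequence of pairwise disjoint
nonempty open sets `O n` there are an infinite set `J` of indices and a point `x` such that every
neighborhood of `x` meets all but finitely many of the `O n` with `n ∈ J`. -/
def IsSequentiallyPseudocompact (X : Type*) [TopologicalSpace X] : Prop :=
  ∀ O : ℕ → Set X, (∀ n, IsOpen (O n)) → (∀ n, (O n).Nonempty) →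
    (∀ m n, m ≠ n → Disjoint (O m) (O n)) →
    ∃ J : Set ℕ, J.Infinite ∧ ∃ x : X, ∀ U ∈ nhds x, {n | n ∈ J ∧ U ∩ O n = ∅}.Finite

/-- A topological space is scattered if every nonempty subset `S` has a point that is isolated
in `S`. -/
def IsScatteredSpace (X : Type*) [TopologicalSpace X] : Prop :=
  ∀ S : Set X, S.Nonempty → ∃ x ∈ S, ∃ U : Set X, IsOpen U ∧ U ∩ S = {x}

/-- A topological space is `ψ`-`ω`-scattered if every nonempty closed subset `F` has a point of
countable pseudocharacter in `F`, that is, a point `x` such that `{x}` is the intersection of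
countably many (relatively) open subsets of the subspace `F`. -/
def IsPsiOmegaScattered (X : Type*) [TopologicalSpace X] : Prop :=
  ∀ F : Set X, IsClosed F → F.Nonempty → ∃ x : F, IsGδ ({x} : Set F)

/-- The topological space admits a group structure that makes it a topological group. -/
def AdmitsTopologicalGroup (X : Type*) [TopologicalSpace X] : Prop :=
  ∃ _ : Group X, IsTopologicalGroup X

/-! Call a space subsequentially feebly compact if every sequence of neighborhoods `O n` of points
`x n` has a subsequence converging to a point, in the sense that each neighborhood of the limit
meets all but finitely many members of the subsequence. This implies sequential pseudocompactness,
and that implies pseudocompactness, because an unbounded continuous function yields a sequence of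
disjoint open sets on which its absolute value tends to infinity.

The property passes to arbitrary products (`IsSubseqFeeblyCompact.pi`): boxes have finite support,
so only countably many factors matter, and a diagonal argument settles these. It remains to treat
the factors. The only consequence of pseudocompactness used there is that, in a completely regular
space, neighborhoods of a sequence of points always accumulate somewhere
(`IsPseudocompact.exists_frequently_inter_nonempty`).

* Scattered spaces and first countable T1 spaces are `ψ`-`ω`-scattered. In a regular
  `ψ`-`ω`-scattered space, let `x` be a point of countable pseudocharacter in the closed set `F` of
  accumulation points of `O n`. Intersecting suitable `O n` with neighborhoods shrinking to
  `{x}` in `F` yields sets whose subsequences can accumulate only at `x`, so they converge to `x`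
  (`IsPsiOmegaScattered.isSubseqFeeblyCompact`).
* In a topological group, choose symmetric closed neighborhoods `V n` of `1` with
  `V (n + 1) * V (n + 1) ⊆ V n` and `x n • V n ⊆ O n`, and put `N = ⋂ n, V n`. If `g` is an
  accumulation point of `x n • V n`, then along a subsequence `x n` approaches `g` modulo every
  `V k`. Pseudocompactness upgrades this to convergence in the quotient topology of `G ⧸ N`: for
  each neighborhood `W` of `1`, eventually `x n ∈ W * g * N`. As `x n • N ⊆ O n`, the sets `O n`
  converge to `g` along the subsequence (`isSubseqFeeblyCompact_of_isTopologicalGroup`).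
-/

open Set Filter Topology
open scoped Pointwise

/-! ### Accumulation of open sets in pseudocompact spaces -/

/-- Pseudocompact completely regular spaces are feebly compact: otherwise the relevant `O n` form a
locally finite family, and a sum of bump functions of height `n` supported in `O n` is continuous
and unbounded. -/
theorem IsPseudocompact.exists_frequently_inter_nonempty {X : Type*} [TopologicalSpace X]
    [CompletelyRegularSpace X] (hX : IsPseudocompact X) {x : ℕ → X} {O : ℕ → Set X}
    (hO : ∀ n, O n ∈ 𝓝 (x n)) {p : ℕ → Prop} (hp : ∃ᶠ n in atTop, p n) :
    ∃ y, ∀ U ∈ 𝓝 y, ∃ᶠ n in atTop, p n ∧ (U ∩ O n).Nonempty := by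
  classical
  by_contra! H
  have hbump : ∀ n, ∃ f : X → ℝ, Continuous f ∧ f (x n) = 1 ∧ (∀ y, 0 ≤ f y) ∧
      ∀ y ∉ O n, f y = 0 := by
    intro n
    obtain ⟨f, hf, h0, h1⟩ := CompletelyRegularSpace.completely_regular_isOpen (x n)
      (interior (O n)) isOpen_interior (mem_interior_iff_mem_nhds.2 (hO n))
    refine ⟨fun y ↦ 1 - f y, by fun_prop, by simp [h0], fun y ↦ by linarith [(f y).2.2],
      fun y hy ↦ ?_⟩
    have := h1 (show y ∈ (interior (O n))ᶜ from fun h ↦ hy (interior_subset h))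
    simp [this]
  choose f hf hfx hf0 hfO using hbump
  let g : ℕ → X → ℝ := fun n y ↦ if p n then n * f n y else 0
  have hg : ∀ n, Continuous (g n) := by
    intro n
    by_cases h : p n
    · simpa [g, h] using (hf n).const_mul (n : ℝ)
    · simpa [g, h] using continuous_const
  have hg0 : ∀ n y, 0 ≤ g n y := by
    intro n y
    by_cases h : p n
    · simpa [g, h] using mul_nonneg n.cast_nonneg (hf0 n y)
    · simp [g, h]
  have hlf : LocallyFinite fun n ↦ Function.support (g n) := by
    intro y
    obtain ⟨U, hU, hy⟩ := H y
    refine ⟨U, hU, ?_⟩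
    rw [← not_infinite, ← Nat.frequently_atTop_iff_infinite]
    intro h
    refine (h.and_eventually hy).exists.elim fun n hn ↦ ?_
    obtain ⟨⟨z, hz, hzU⟩, hn⟩ := hn
    have hz : g n z ≠ 0 := hz
    have hpn : p n := by
      by_contra hpn
      simp [g, hpn] at hz
    have hzO : z ∈ O n := by
      by_contra hzO
      simp [g, hfO n z hzO] at hz
    have : z ∈ U ∩ O n := ⟨hzU, hzO⟩
    simp [hn hpn] at this
  obtain ⟨C, hC⟩ := hX (fun y ↦ ∑ᶠ n, g n y) (continuous_finsum hg hlf)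
  obtain ⟨m, hm⟩ := exists_nat_gt C
  obtain ⟨n, hpn, hmn⟩ := (hp.and_eventually (eventually_ge_atTop m)).exists
  have h1 : g n (x n) ≤ ∑ᶠ k, g k (x n) :=
    single_le_finsum n (hlf.point_finite (x n)) fun k ↦ hg0 k (x n)
  have h2 : g n (x n) = n := by simp [g, hpn, hfx]
  have h3 : (m : ℝ) ≤ n := by exact_mod_cast hmn
  linarith [le_abs_self (∑ᶠ k, g k (x n)), hC (x n)]

/-! ### Subsequential feeble compactness -/

/-- Every sequence of neighborhoods `O n` of points `x n` has, within every infinite set of indices,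
an infinite set `B` along which the `O n` converge to some point `y`. The sets `O n` are not
required to be disjoint or open, and the passage to an index set `A` is part of the definition so
that it can be iterated. -/
def IsSubseqFeeblyCompact (X : Type*) [TopologicalSpace X] : Prop :=
  ∀ (x : ℕ → X) (O : ℕ → Set X), (∀ n, O n ∈ 𝓝 (x n)) → ∀ A : Set ℕ, A.Infinite →
    ∃ B ⊆ A, B.Infinite ∧ ∃ y, ∀ U ∈ 𝓝 y, ∀ᶠ n in atTop, n ∈ B → (U ∩ O n).Nonempty

theorem IsSubseqFeeblyCompact.isSequentiallyPseudocompact {X : Type*} [TopologicalSpace X]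
    (hX : IsSubseqFeeblyCompact X) : IsSequentiallyPseudocompact X := by
  intro O hO hne _
  choose x hx using hne
  obtain ⟨B, -, hB, y, hy⟩ := hX x O (fun n ↦ (hO n).mem_nhds (hx n)) univ infinite_univ
  refine ⟨B, hB, y, fun U hU ↦ ?_⟩
  rw [← not_infinite, ← Nat.frequently_atTop_iff_infinite]
  intro h
  obtain ⟨n, ⟨hn, hn'⟩, hne⟩ := (h.and_eventually (hy U hU)).exists
  exact (hne hn).ne_empty hn'

theorem IsSequentiallyPseudocompact.isPseudocompact {X : Type*} [TopologicalSpace X]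
    (hX : IsSequentiallyPseudocompact X) : IsPseudocompact X := by
  intro f hf
  by_contra! H
  -- Points at which `|f|` grows by more than `1` at each step.
  choose s hs using H
  let x : ℕ → X := fun n ↦ Nat.rec (s 0) (fun _ y ↦ s (|f y| + 1)) n
  have hstep : ∀ n, |f (x n)| + 1 < |f (x (n + 1))| := fun n ↦ hs _
  have hlt : ∀ m n, m < n → |f (x m)| + 1 < |f (x n)| := by
    intro m n hmn
    induction n, hmn using Nat.le_induction with
    | base => exact hstep m
    | succ n _ ih => linarith [hstep n]
  have hge : ∀ n : ℕ, (n : ℝ) ≤ |f (x n)| := by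
    intro n
    induction n with
    | zero => simp
    | succ n ih => push_cast; linarith [hstep n]
  obtain ⟨J, hJ, y, hy⟩ := hX (fun n ↦ {z | |(|f z| - |f (x n)|)| < 1 / 2})
    (fun n ↦ isOpen_lt (by fun_prop) continuous_const) (fun n ↦ ⟨x n, by simp⟩) (by
      intro m n hmn
      rw [Set.disjoint_left]
      intro z hm hn
      simp only [mem_ofPred_eq, abs_lt] at hm hn
      rcases lt_or_gt_of_ne hmn with h | h
      · linarith [hlt _ _ h]
      · linarith [hlt _ _ h])
  have hU : {z | |f z| < |f y| + 1} ∈ 𝓝 y :=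
    (isOpen_lt (by fun_prop) continuous_const).mem_nhds (by simp)
  obtain ⟨m, hm⟩ := exists_nat_gt (|f y| + 2)
  obtain ⟨n, ⟨hnJ, hn⟩, hmn⟩ := ((hJ.sdiff (hy _ hU))).exists_gt m
  have : ({z | |f z| < |f y| + 1} ∩ {z | |(|f z| - |f (x n)|)| < 1 / 2}).Nonempty := by
    by_contra h
    exact hn ⟨hnJ, not_nonempty_iff_eq_empty.1 h⟩
  obtain ⟨z, hz, hz'⟩ := this
  simp only [mem_ofPred_eq] at hz hz'
  rw [abs_lt] at hz'
  have : (m : ℝ) < n := by exact_mod_cast hmn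
  linarith [hge n]

/-- To verify convergence along the range of a strictly increasing `φ`, it suffices to do so for the
sequence `O (φ k)`. -/
theorem eventually_mem_range_imp {φ : ℕ → ℕ} (hφ : StrictMono φ) {p : ℕ → Prop}
    (h : ∀ᶠ k in atTop, p (φ k)) : ∀ᶠ n in atTop, n ∈ range φ → p n := by
  obtain ⟨K, hK⟩ := eventually_atTop.1 h
  filter_upwards [eventually_ge_atTop (φ K)]
  rintro _ hn ⟨k, rfl⟩
  exact hK k (hφ.le_iff_le.1 hn)

/-! ### Products -/

/-- Diagonal argument: properties of infinite index sets that hold on a subset of every infinite set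
and depend only on tails hold simultaneously for countably many indices. -/
theorem exists_infinite_forall_of_almost_subset {Q : ℕ → Set ℕ → Prop}
    (hQ : ∀ i A, A.Infinite → ∃ B ⊆ A, B.Infinite ∧ Q i B)
    (hmono : ∀ i A B, (∀ᶠ n in atTop, n ∈ B → n ∈ A) → Q i A → Q i B)
    {A : Set ℕ} (hA : A.Infinite) : ∃ B ⊆ A, B.Infinite ∧ ∀ i, Q i B := by
  choose! b hbA hbi hbQ using hQ
  let S : ℕ → Set ℕ := fun n ↦ Nat.rec A (fun i T ↦ b i T) n
  have hSi : ∀ n, (S n).Infinite := by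
    intro n
    induction n with
    | zero => exact hA
    | succ n ih => exact hbi n _ ih
  have hanti : Antitone S := antitone_nat_of_succ_le fun n ↦ hbA n _ (hSi n)
  obtain ⟨φ, hφ, hφS⟩ := extraction_forall_of_frequently (P := fun n k ↦ k ∈ S n)
    fun n ↦ Nat.frequently_atTop_iff_infinite.2 (hSi n)
  refine ⟨range φ, ?_, infinite_range_of_injective hφ.injective, fun i ↦ ?_⟩
  · rintro _ ⟨k, rfl⟩
    exact hanti (Nat.zero_le k) (hφS k)
  · refine hmono i (S (i + 1)) _ (eventually_mem_range_imp hφ ?_) (hbQ i _ (hSi i))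
    filter_upwards [eventually_ge_atTop (i + 1)] with k hk using hanti hk (hφS k)

theorem IsSubseqFeeblyCompact.pi {H : Type*} {X : H → Type*} [∀ h, TopologicalSpace (X h)]
    (hX : ∀ h, IsSubseqFeeblyCompact (X h)) : IsSubseqFeeblyCompact (∀ h, X h) := by
  classical
  intro x O hO A hA
  have hbox : ∀ n, ∃ I : Set H, I.Finite ∧ ∃ u : ∀ h, Set (X h), (∀ h, u h ∈ 𝓝 (x n h)) ∧
      I.pi u ⊆ O n := by
    intro n
    have := hO n
    rwa [nhds_pi, Filter.mem_pi] at this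
  choose I hI u hu huO using hbox
  let D : Set H := ⋃ n, I n
  have hD : D.Countable := countable_iUnion fun n ↦ (hI n).countable
  let Q : H → Set ℕ → Prop := fun h B ↦
    ∃ y, ∀ U ∈ 𝓝 y, ∀ᶠ n in atTop, n ∈ B → (U ∩ u n h).Nonempty
  have hQ : ∀ h B, B.Infinite → ∃ C ⊆ B, C.Infinite ∧ Q h C := fun h B hB ↦
    hX h (fun n ↦ x n h) (fun n ↦ u n h) (fun n ↦ hu n h) B hB
  have hmono : ∀ h B C, (∀ᶠ n in atTop, n ∈ C → n ∈ B) → Q h B → Q h C := by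
    rintro h B C hBC ⟨y, hy⟩
    refine ⟨y, fun U hU ↦ ?_⟩
    filter_upwards [hBC, hy U hU] with n h1 h2 h3 using h2 (h1 h3)
  obtain ⟨B, hBA, hB, hBQ⟩ : ∃ B ⊆ A, B.Infinite ∧ ∀ h ∈ D, Q h B := by
    rcases D.eq_empty_or_nonempty with hD0 | hDne
    · exact ⟨A, Subset.rfl, hA, by simp [hD0]⟩
    · obtain ⟨e, he⟩ := hD.exists_eq_range hDne
      obtain ⟨B, hBA, hB, hBQ⟩ := exists_infinite_forall_of_almost_subset (Q := fun i ↦ Q (e i))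
        (fun i ↦ hQ (e i)) (fun i ↦ hmono (e i)) hA
      refine ⟨B, hBA, hB, ?_⟩
      rw [he]
      rintro _ ⟨i, rfl⟩
      exact hBQ i
  choose y hy using hBQ
  -- Coordinates outside `D` are not restricted by any of the boxes.
  refine ⟨B, hBA, hB, fun h ↦ if hh : h ∈ D then y h hh else x 0 h, fun U hU ↦ ?_⟩
  rw [nhds_pi, Filter.mem_pi] at hU
  obtain ⟨K, hK, v, hv, hvU⟩ := hU
  have hev : ∀ᶠ n in atTop, ∀ h ∈ K, h ∈ D → n ∈ B → (v h ∩ u n h).Nonempty := by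
    rw [eventually_all_finite hK]
    intro h _
    by_cases hh : h ∈ D
    · have := hv h
      rw [dif_pos hh] at this
      filter_upwards [hy h hh _ this] with n hn _ using hn
    · simp [hh]
  filter_upwards [hev] with n hn hnB
  have hz : ∀ h, ∃ z : X h, (h ∈ K → z ∈ v h) ∧ (h ∈ I n → z ∈ u n h) := by
    intro h
    by_cases hhI : h ∈ I n
    · by_cases hhK : h ∈ K
      · obtain ⟨z, h1, h2⟩ := hn h hhK (mem_iUnion.2 ⟨n, hhI⟩) hnB
        exact ⟨z, fun _ ↦ h1, fun _ ↦ h2⟩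
      · exact ⟨x n h, fun hh ↦ absurd hh hhK, fun _ ↦ mem_of_mem_nhds (hu n h)⟩
    · exact ⟨_, fun _ ↦ mem_of_mem_nhds (hv h), fun hh ↦ absurd hh hhI⟩
  choose z hzK hzI using hz
  exact ⟨z, hvU fun h hh ↦ hzK h hh, huO n fun h hh ↦ hzI h hh⟩

/-! ### `ψ`-`ω`-scattered spaces -/

theorem IsScatteredSpace.isPsiOmegaScattered {X : Type*} [TopologicalSpace X]
    (hX : IsScatteredSpace X) : IsPsiOmegaScattered X := by
  intro F _ hF
  obtain ⟨x, hx, U, hU, hUF⟩ := hX F hF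
  refine ⟨⟨x, hx⟩, IsOpen.isGδ ?_⟩
  convert hU.preimage (continuous_subtype_val (p := (· ∈ F))) using 1
  ext ⟨y, hy⟩
  have := Set.ext_iff.1 hUF y
  simpa [hy] using this.symm

theorem isPsiOmegaScattered_of_firstCountable {X : Type*} [TopologicalSpace X] [T1Space X]
    [FirstCountableTopology X] : IsPsiOmegaScattered X := fun _ _ ⟨x, hx⟩ ↦
  ⟨⟨x, hx⟩, IsGδ.singleton _⟩

theorem IsPsiOmegaScattered.isSubseqFeeblyCompact {X : Type*} [TopologicalSpace X]
    [CompletelyRegularSpace X] (hX : IsPsiOmegaScattered X) (hpc : IsPseudocompact X) :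
    IsSubseqFeeblyCompact X := by
  intro x O hO A hA
  let F : Set X := {y | ∀ U ∈ 𝓝 y, ∃ᶠ n in atTop, n ∈ A ∧ (U ∩ interior (O n)).Nonempty}
  have hFc : IsClosed F := by
    rw [← isOpen_compl_iff, isOpen_iff_mem_nhds]
    intro y hy
    simp only [F, mem_compl_iff, mem_ofPred_eq, not_forall] at hy
    obtain ⟨U, hU, hyU⟩ := hy
    filter_upwards [eventually_mem_nhds_iff.2 hU] with z hz hzF using hyU (hzF U hz)
  have hFne : F.Nonempty := hpc.exists_frequently_inter_nonempty
    (fun n ↦ interior_mem_nhds.2 (hO n)) (Nat.frequently_atTop_iff_infinite.2 hA)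
  obtain ⟨⟨a, ha⟩, haG⟩ := hX F hFc hFne
  obtain ⟨G', hG'o, hG'⟩ := haG.eq_iInter_nat
  choose G hGo hG using fun n ↦ isOpen_induced_iff.1 (hG'o n)
  have haG : ∀ n, a ∈ G n := by
    intro n
    have : (⟨a, ha⟩ : F) ∈ G' n := mem_iInter.1 (hG' ▸ mem_singleton _) n
    rwa [← hG n] at this
  have hGF : ∀ y ∈ F, (∀ n, y ∈ G n) → y = a := by
    intro y hy hyG
    have : (⟨y, hy⟩ : F) ∈ ⋂ n, G' n := mem_iInter.2 fun n ↦ by rw [← hG n]; exact hyG n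
    rw [← hG'] at this
    exact congrArg Subtype.val this
  choose T hTa hTc hTG using fun n ↦
    exists_mem_nhds_isClosed_subset ((hGo n).mem_nhds (haG n))
  let V : ℕ → Set X := fun k ↦ ⋂ j ∈ Iic k, T j
  have hV : ∀ k, V k ∈ 𝓝 a := fun k ↦ (biInter_mem (finite_Iic k)).2 fun j _ ↦ hTa j
  obtain ⟨φ, hφ, hφP⟩ := extraction_forall_of_frequently
    fun k ↦ ha (interior (V k)) (interior_mem_nhds.2 (hV k))
  choose hφA z hz using hφP
  refine ⟨range φ, by rintro _ ⟨k, rfl⟩; exact hφA k, infinite_range_of_injective hφ.injective,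
    a, fun U hU ↦ eventually_mem_range_imp hφ (p := fun n ↦ (U ∩ O n).Nonempty) ?_⟩
  by_contra hcon
  rw [not_eventually] at hcon
  -- A subsequence avoiding `U` would accumulate at a point of `F` lying in every `G n`, hence at `a`.
  obtain ⟨b, hb⟩ := hpc.exists_frequently_inter_nonempty (x := z)
    (O := fun k ↦ interior (V k) ∩ interior (O (φ k)))
    (fun k ↦ (isOpen_interior.inter isOpen_interior).mem_nhds (hz k)) hcon
  have hbF : b ∈ F := by
    intro W hW
    refine hφ.tendsto_atTop.frequently ((hb W hW).mono ?_)
    rintro k ⟨-, w, hwW, -, hwO⟩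
    exact ⟨hφA k, w, hwW, hwO⟩
  have hba : b = a := by
    refine hGF b hbF fun n ↦ hTG n ?_
    rw [← (hTc n).closure_eq, mem_closure_iff_nhds]
    intro W hW
    obtain ⟨k, ⟨-, w, hwW, hwV, -⟩, hk⟩ :=
      ((hb W hW).and_eventually (eventually_ge_atTop n)).exists
    exact ⟨w, hwW, mem_iInter₂.1 (interior_subset hwV) n hk⟩
  obtain ⟨k, hk, w, hwU, -, hwO⟩ := (hb U (hba ▸ hU)).exists
  exact hk ⟨w, hwU, interior_subset hwO⟩

/-! ### Topological groups -/

/-- The neighborhoods `V n` play the role of a countable base at `1` for a coarser group uniformity,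
fine enough to see the prescribed neighborhoods `S n`. -/
theorem exists_seq_nhds_one_mul_subset {G : Type*} [Group G] [TopologicalSpace G]
    [IsTopologicalGroup G] {S : ℕ → Set G} (hS : ∀ n, S n ∈ 𝓝 1) :
    ∃ V : ℕ → Set G, (∀ n, V n ∈ 𝓝 1) ∧ (∀ n, IsClosed (V n)) ∧ (∀ n, (V n)⁻¹ = V n) ∧
      (∀ n, V (n + 1) * V (n + 1) ⊆ V n) ∧ ∀ n, V n ⊆ S n := by
  choose! c hc1 hcc hci hcm using fun (U : Set G) (hU : U ∈ 𝓝 1) ↦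
    exists_closed_nhds_one_inv_eq_mul_subset hU
  have hcs : ∀ U ∈ 𝓝 (1 : G), c U ⊆ U := fun U hU v hv ↦
    hcm U hU ⟨v, hv, 1, mem_of_mem_nhds (hc1 U hU), mul_one v⟩
  let V : ℕ → Set G := fun n ↦ Nat.rec (c (S 0)) (fun n W ↦ c (W ∩ S (n + 1))) n
  have hV1 : ∀ n, V n ∈ 𝓝 1 := by
    intro n
    induction n with
    | zero => exact hc1 _ (hS 0)
    | succ n ih => exact hc1 _ (inter_mem ih (hS _))
  refine ⟨V, hV1, fun n ↦ ?_, fun n ↦ ?_, fun n ↦ ?_, fun n ↦ ?_⟩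
  · cases n with
    | zero => exact hcc _ (hS 0)
    | succ n => exact hcc _ (inter_mem (hV1 n) (hS _))
  · cases n with
    | zero => exact hci _ (hS 0)
    | succ n => exact hci _ (inter_mem (hV1 n) (hS _))
  · exact (hcm _ (inter_mem (hV1 n) (hS _))).trans inter_subset_left
  · cases n with
    | zero => exact hcs _ (hS 0)
    | succ n => exact (hcs _ (inter_mem (hV1 n) (hS _))).trans inter_subset_right

theorem isSubseqFeeblyCompact_of_isTopologicalGroup {G : Type*} [Group G] [TopologicalSpace G]
    [IsTopologicalGroup G] [CompletelyRegularSpace G] (hpc : IsPseudocompact G) :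
    IsSubseqFeeblyCompact G := by
  intro x O hO A hA
  obtain ⟨V, hV1, hVc, hVi, hVm, hVO⟩ := exists_seq_nhds_one_mul_subset
    (S := fun n ↦ (x n * ·) ⁻¹' O n)
    fun n ↦ (continuous_const_mul (x n)).continuousAt.preimage_mem_nhds (by simpa using hO n)
  have hanti : Antitone V := antitone_nat_of_succ_le fun n v hv ↦
    hVm n ⟨v, hv, 1, mem_of_mem_nhds (hV1 _), mul_one v⟩
  have hinv : ∀ {n v}, v ∈ V n → v⁻¹ ∈ V n := fun {n v} hv ↦ by
    rw [← hVi n]; simpa using hv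
  have hsmul : ∀ (g : G) n, g • V n ∈ 𝓝 g := fun g n ↦ by
    simpa using smul_mem_nhds_smul g (hV1 n)
  obtain ⟨g, hg⟩ := hpc.exists_frequently_inter_nonempty (fun n ↦ hsmul (x n) n)
    (Nat.frequently_atTop_iff_infinite.2 hA)
  have hgx : ∀ k, ∃ᶠ n in atTop, n ∈ A ∧ g⁻¹ * x n ∈ V k := by
    intro k
    refine ((hg _ (hsmul g (k + 1))).and_eventually (eventually_ge_atTop (k + 1))).mono ?_
    rintro n ⟨⟨hnA, w, ⟨v, hv, hvw⟩, ⟨v', hv', hvw'⟩⟩, hn⟩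
    refine ⟨hnA, hVm k ⟨v, hv, v'⁻¹, hinv (hanti hn hv'), ?_⟩⟩
    simp only [smul_eq_mul] at hvw hvw' ⊢
    rw [← hvw'] at hvw
    rw [eq_inv_mul_iff_mul_eq, ← mul_assoc, hvw, mul_inv_cancel_right]
  -- The shift by one makes `g • V k` a neighborhood of `x (φ k)`.
  obtain ⟨φ, hφ, hφP⟩ := extraction_forall_of_frequently fun k ↦ hgx (k + 1)
  choose hφA hφV using hφP
  refine ⟨range φ, by rintro _ ⟨k, rfl⟩; exact hφA k, infinite_range_of_injective hφ.injective,
    g, fun U hU ↦ eventually_mem_range_imp hφ (p := fun n ↦ (U ∩ O n).Nonempty) ?_⟩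
  by_contra hcon
  rw [not_eventually] at hcon
  obtain ⟨W, hW1, -, hWi, hWm⟩ := exists_closed_nhds_one_inv_eq_mul_subset
    (U := (· * g) ⁻¹' U)
    ((continuous_mul_const g).continuousAt.preimage_mem_nhds (by simpa using hU))
  have hWx : ∀ a : G, (· * a⁻¹) ⁻¹' W ∈ 𝓝 a := fun a ↦
    (continuous_mul_const a⁻¹).continuousAt.preimage_mem_nhds (by simpa using hW1)
  have hnhds : ∀ k, g • V k ∩ (· * (x (φ k))⁻¹) ⁻¹' W ∈ 𝓝 (x (φ k)) := by
    intro k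
    refine inter_mem (mem_of_superset (hsmul (x (φ k)) (k + 1)) ?_) (hWx _)
    rintro _ ⟨v, hv, rfl⟩
    refine mem_smul_set_iff_inv_smul_mem.2 (hVm k ⟨_, hφV k, v, hv, ?_⟩)
    simp [mul_assoc]
  -- `V` is translated on the left and `W` on the right: this puts an accumulation point `b` into
  -- `g * N` and some `x (φ k)` into `W * W * b`, without normality of `N = ⋂ n, V n`.
  obtain ⟨b, hb⟩ := hpc.exists_frequently_inter_nonempty hnhds hcon
  have hbN : ∀ n, g⁻¹ * b ∈ V n := by
    intro n
    have : b ∈ g • V n := by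
      rw [← ((hVc n).smul g).closure_eq, mem_closure_iff_nhds]
      intro T hT
      obtain ⟨k, ⟨-, w, hwT, hwV, -⟩, hk⟩ :=
        ((hb T hT).and_eventually (eventually_ge_atTop n)).exists
      exact ⟨w, hwT, smul_set_mono (hanti hk) hwV⟩
    simpa using mem_smul_set_iff_inv_smul_mem.1 this
  obtain ⟨k, hk, w, hwb, -, hwx⟩ := (hb _ (hWx b)).exists
  simp only [mem_preimage] at hwb hwx
  refine hk ⟨x (φ k) * (g⁻¹ * b)⁻¹, ?_, hVO _ (hinv (hbN _))⟩
  have : (w * (x (φ k))⁻¹)⁻¹ * (w * b⁻¹) * g ∈ U :=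
    hWm ⟨_, by rw [← hWi]; simpa using hwx, _, hwb, rfl⟩
  convert this using 1
  group

/-- The second conjunct is the special case of products of pseudocompact Hausdorff topological
groups. -/
theorem corollary4 :
    (∀ (H : Type u) (X : H → Type v) [∀ h, TopologicalSpace (X h)],
      (∀ h, T35Space (X h)) →
      (∀ h, IsPseudocompact (X h)) →
      (∀ h, IsScatteredSpace (X h) ∨ FirstCountableTopology (X h) ∨
        IsPsiOmegaScattered (X h) ∨ AdmitsTopologicalGroup (X h)) →
      IsPseudocompact (∀ h, X h) ∧ IsSequentiallyPseudocompact (∀ h, X h)) ∧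
    (∀ (H : Type u) (G : H → Type v) [∀ h, Group (G h)] [∀ h, TopologicalSpace (G h)]
      [∀ h, IsTopologicalGroup (G h)] [∀ h, T2Space (G h)],
      (∀ h, IsPseudocompact (G h)) → IsPseudocompact (∀ h, G h)) := by
  refine ⟨fun H X _ hT hpc hX ↦ ?_, fun H G _ _ _ _ hpc ↦ ?_⟩
  · have hpi : IsSubseqFeeblyCompact (∀ h, X h) := by
      refine IsSubseqFeeblyCompact.pi fun h ↦ ?_
      have := hT h
      rcases hX h with hs | hf | hp | ⟨_, _⟩
      · exact hs.isPsiOmegaScattered.isSubseqFeeblyCompact (hpc h)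
      · exact isPsiOmegaScattered_of_firstCountable.isSubseqFeeblyCompact (hpc h)
      · exact hp.isSubseqFeeblyCompact (hpc h)
      · exact isSubseqFeeblyCompact_of_isTopologicalGroup (hpc h)
    exact ⟨hpi.isSequentiallyPseudocompact.isPseudocompact, hpi.isSequentiallyPseudocompact⟩
  · refine (IsSubseqFeeblyCompact.pi fun h ↦ ?_).isSequentiallyPseudocompact.isPseudocompact
    let := IsTopologicalGroup.rightUniformSpace (G h)
    exact isSubseqFeeblyCompact_of_isTopologicalGroup (hpc h)
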